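/- Let $k\ge 3$ and let $f_0$ be a normal form of a Whitney umbrella, $$f_0(u,v)=\Bigl(u,\;uv+\sum_{i=3}^k\frac{b_i}{i!}v^i+R_1(u,v),\;\sum_{j=2}^k\sum_{p+q=j}\frac{a_{pq}}{p!\,q!}u^pv^q+R_2(u,v)\Bigr),\qquad a_{02}>0,$$ with real coefficients, where $R_1,R_2$ are real functions that are $C^\infty$ near the origin and whose derivatives of order $\le k$ all vanish at the origin. For $r>0$ put $\hat\gamma(\theta)=f_0(r\cos\theta,r\sin\theta)$, and let $\tilde{\mathbf n}(r,\theta)$ be the unit normal $(f_0)_u\times(f_0)_v/|(f_0)_u\times(f_0)_v|$ at $(r\cos\theta,r\sin\theta)$. A frame of the type considered consists of $\mathbf e,\mathbf b,\mathbf n$ along $\hat\gamma$, differentiable in $\theta$, with $\hat\gamma_\theta=l\,\mathbf e$ for a function $l$, $|\mathbf e|=|\mathbf n|=1$, $\mathbf n=-\mathbf e\times\tilde{\mathbf n}$ (so $\mathbf e\cdot\mathbf n=0$) and $\mathbf b=-\mathbf e\times\mathbf n$; the functions $\kappa_1,\kappa_2,\kappa_3$ of $(r,\theta)$ are given by $$\mathbf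 e'=\kappa_1\mathbf b+\kappa_2\mathbf n,\qquad \mathbf b'=-\kappa_1\mathbf e+\kappa_3\mathbf n,\qquad \mathbf n'=-\kappa_2\mathbf e-\kappa_3\mathbf b\qquad({}'=d/d\theta).$$ A function $x_f(\theta)$ is called a first term of a function $x(r,\theta)$ on a set $S$ of angles if $x_f$ is not identically zero on $S$ and there are an integer $i\ge0$ and a function $x_0$ without zeros on $S$ such that, for each $\theta\in S$, $x(r,\theta)=x_f(\theta)x_0(\theta)r^i+O(r^{i+1})$ as $r\to+0$. Let $$g(s)=(a_{11}^2+1)s^4+a_{11}a_{02}s^3+3(a_{11}^2+1)s^2+a_{11}(4a_{02}-a_{20})s+a_{02}(a_{02}-a_{20}).$$ Theorem. For all sufficiently small $r>0$ such a frame exists. For every choice of such frames for all small $r>0$, the function $\kappa_2(r,\theta)$ has a first term on $S=\{\theta\in\mathbb R:\sin\theta\ne0\}$, and every first term $c$ of $\kappa_2$ on $S$ satisfies, for each $\theta\in S$, $$c(\theta)=0\iff g\Bigl(\frac{\cos\theta}{\sin\theta}\Bigr)=0 .$$ -/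

import Mathlib

open scoped Topology ContDiff Matrix

/-- `R` is a smooth function germ at the origin of the plane of order at least `m`: it is
`C^∞` near `0` and all its derivatives of order less than `m` vanish at `0`. -/
def IsGermOfOrder (m : ℕ) (R : ℝ × ℝ → ℝ) : Prop :=
  (∀ᶠ p in 𝓝 (0 : ℝ × ℝ), ContDiffAt ℝ ∞ R p) ∧
    ∀ j : ℕ, j < m → iteratedFDeriv ℝ j R 0 = 0

/-- The normal form of a Whitney umbrella
`(u, u v + ∑_{i=3}^k b_i v^i / i! + R₁, ∑_{j=2}^k ∑_{p+q=j} a_{pq} u^p v^q / (p! q!) + R₂)`. -/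
noncomputable def whitneyNormalForm (k : ℕ) (a : ℕ → ℕ → ℝ) (b : ℕ → ℝ) (R₁ R₂ : ℝ × ℝ → ℝ)
    (p : ℝ × ℝ) : Fin 3 → ℝ :=
  ![p.1,
    p.1 * p.2 + ∑ i ∈ Finset.Icc 3 k, b i / (i.factorial : ℝ) * p.2 ^ i + R₁ p,
    ∑ j ∈ Finset.Icc 2 k, ∑ q ∈ Finset.HasAntidiagonal.antidiagonal j,
      a q.1 q.2 / ((q.1.factorial : ℝ) * (q.2.factorial : ℝ)) * p.1 ^ q.1 * p.2 ^ q.2 + R₂ p]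

/-- The normal vector `f_u × f_v`. -/
noncomputable def normalVec (f : ℝ × ℝ → Fin 3 → ℝ) (p : ℝ × ℝ) : Fin 3 → ℝ :=
  (fderiv ℝ f p (1, 0)) ⨯₃ (fderiv ℝ f p (0, 1))

/-- The unit normal vector `f_u × f_v / |f_u × f_v|` (Euclidean length). -/
noncomputable def unitNormal (f : ℝ × ℝ → Fin 3 → ℝ) (p : ℝ × ℝ) : Fin 3 → ℝ :=
  (Real.sqrt (normalVec f p ⬝ᵥ normalVec f p))⁻¹ • normalVec f p

/-- The point `(r cos θ, r sin θ)`. -/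
noncomputable def polarPt (r θ : ℝ) : ℝ × ℝ := (r * Real.cos θ, r * Real.sin θ)

/-- `e, b, n` is an orthonormal frame along the space curve `γ` with `γ' = l e`, `b = -e × n`,
and `κ₁, κ₂, κ₃` are the functions in its Frenet-Serre type formula. -/
structure IsFrenetFrame (γ : ℝ → Fin 3 → ℝ) (l : ℝ → ℝ) (e b n : ℝ → Fin 3 → ℝ)
    (κ₁ κ₂ κ₃ : ℝ → ℝ) : Prop where
  tangent : ∀ t, HasDerivAt γ (l t • e t) t
  unit_e : ∀ t, e t ⬝ᵥ e t = 1
  unit_n : ∀ t, n t ⬝ᵥ n t = 1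
  orth : ∀ t, e t ⬝ᵥ n t = 0
  b_eq : ∀ t, b t = -(e t ⨯₃ n t)
  deriv_e : ∀ t, HasDerivAt e (κ₁ t • b t + κ₂ t • n t) t
  deriv_b : ∀ t, HasDerivAt b (-(κ₁ t) • e t + κ₃ t • n t) t
  deriv_n : ∀ t, HasDerivAt n (-(κ₂ t) • e t - κ₃ t • b t) t

/-- The frame along the image under `f` of the circle of radius `r`, parametrized by the angle,
whose third vector is `n = -e × ñ`, with `ñ` the unit normal of `f` along that curve. -/
def IsConormalFrame (f : ℝ × ℝ → Fin 3 → ℝ) (r : ℝ) (l : ℝ → ℝ) (e b n : ℝ → Fin 3 → ℝ)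
    (κ₁ κ₂ κ₃ : ℝ → ℝ) : Prop :=
  IsFrenetFrame (fun θ => f (polarPt r θ)) l e b n κ₁ κ₂ κ₃ ∧
    ∀ θ, n θ = -(e θ ⨯₃ unitNormal f (polarPt r θ))

/-- `xf` is a first term of the function `x (r, θ)` for `θ ∈ S`, as `r → +0`:
`x (r, θ) = xf (θ) x₀ (θ) r ^ i + O (r ^ (i + 1))` for some `i` and some `x₀` without zeros on `S`.
The order `i` is the one at which `x` starts: `xf` is not identically zero on `S`
(it may vanish at some `θ`). -/
def IsFirstTerm (x : ℝ → ℝ → ℝ) (S : Set ℝ) (xf : ℝ → ℝ) : Prop :=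
  (∃ θ ∈ S, xf θ ≠ 0) ∧
    ∃ (i : ℕ) (x₀ : ℝ → ℝ), (∀ θ ∈ S, x₀ θ ≠ 0) ∧
      ∀ θ ∈ S, (fun r : ℝ => x r θ - xf θ * x₀ θ * r ^ i) =O[𝓝[>] 0] fun r : ℝ => r ^ (i + 1)

/-- The quartic polynomial that governs the geodesic curvature. -/
def quarticG (a20 a11 a02 s : ℝ) : ℝ :=
  (a11 ^ 2 + 1) * s ^ 4 + a11 * a02 * s ^ 3 + 3 * (a11 ^ 2 + 1) * s ^ 2
    + a11 * (4 * a02 - a20) * s + a02 * (a02 - a20)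

/-! Write `T` and `X` for the first and second θ-derivatives of the curve and `ν` for the unit
normal. From `T = l e` and `n = -e × ν` follows `κ₂ |T|² = -X · (T × ν)`. The factor `l` enters
squared, so the right side fixes `κ₂` wherever `T ≠ 0`, whatever frame is chosen. Only the 2-jet
matters: `f₀` is `(u, uv, quadratic form)` plus germs `F`, `G` of order 3, and ∂/∂θ does not lower
the order of such a germ. With `N = f_u × f_v`, so that `ν = N/|N|`, expanding on the circle of
radius `r` gives `|T|² ~ r² sin²θ`, `|N|² ~ r² (cos²θ + (a₁₁ cos θ + a₀₂ sin θ)²)` and `-X · (T × N)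
= r⁴ sin⁴θ g(cot θ) + O(r⁵)`. Hence `κ₂ = r g(cot θ) z(θ) + O(r²)` with `z > 0` when `sin θ ≠ 0`
(`hasLeadingTerm_kappa_two`). As `g` is not the zero polynomial, g(cot θ) is a first term;
`isFirstTerm_iff_of_hasLeadingTerm` shows that all first terms have the same zeros. Existence of
frames (`exists_frenetFrame`) needs `T` and `N` nonzero on whole small circles, including the angles
with `sin θ = 0`. -/

open Filter Asymptotics

/-! ### Calculus of germs of given order -/

namespace IsGermOfOrder

variable {m n : ℕ} {F G : ℝ × ℝ → ℝ}

theorem mono (h : IsGermOfOrder n F) (hmn : m ≤ n) : IsGermOfOrder m F :=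
  ⟨h.1, fun j hj => h.2 j (hj.trans_le hmn)⟩

theorem contDiffAt (h : IsGermOfOrder m F) : ContDiffAt ℝ ∞ F 0 := h.1.self_of_nhds

theorem add (hF : IsGermOfOrder m F) (hG : IsGermOfOrder m G) :
    IsGermOfOrder m (fun p => F p + G p) := by
  refine ⟨?_, fun j hj => ?_⟩
  · filter_upwards [hF.1, hG.1] with p h₁ h₂ using h₁.add h₂
  · have := iteratedFDeriv_add_apply (i := j) (hF.contDiffAt.of_le (mod_cast le_top))
      (hG.contDiffAt.of_le (mod_cast le_top))
    rw [hF.2 j hj, hG.2 j hj, add_zero] at this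
    exact this

theorem mul (hF : IsGermOfOrder m F) (hG : IsGermOfOrder n G) :
    IsGermOfOrder (m + n) (fun p => F p * G p) := by
  refine ⟨?_, fun j hj => ?_⟩
  · filter_upwards [hF.1, hG.1] with p h₁ h₂ using h₁.mul h₂
  · obtain ⟨s, hs, hso, h0⟩ := eventually_nhds_iff.1 (hF.1.and hG.1)
    have h := norm_iteratedFDerivWithin_mul_le (𝕜 := ℝ) (N := ∞) (n := j)
      (fun p hp => (hs p hp).1.contDiffWithinAt) (fun p hp => (hs p hp).2.contDiffWithinAt)
      hso.uniqueDiffOn h0 (mod_cast le_top)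
    simp only [iteratedFDerivWithin_of_isOpen _ hso h0] at h
    rw [Finset.sum_eq_zero] at h
    · exact norm_le_zero_iff.1 h
    · intro i hi
      rcases lt_or_ge i m with him | him
      · simp [hF.2 i him]
      · rw [hG.2 (j - i) (by simp at hi; omega)]
        simp

theorem of_contDiff (hF : ContDiff ℝ ∞ F) : IsGermOfOrder 0 F :=
  ⟨Eventually.of_forall fun _ => hF.contDiffAt, fun j hj => absurd hj (by omega)⟩

theorem one_of_contDiff (hF : ContDiff ℝ ∞ F) (h0 : F 0 = 0) : IsGermOfOrder 1 F := by
  refine ⟨Eventually.of_forall fun _ => hF.contDiffAt, fun j hj => ?_⟩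
  obtain rfl : j = 0 := by omega
  ext v
  simp [h0]

theorem fst : IsGermOfOrder 1 (fun p => p.1) := one_of_contDiff contDiff_fst rfl

theorem snd : IsGermOfOrder 1 (fun p => p.2) := one_of_contDiff contDiff_snd rfl

theorem const_mul (c : ℝ) (hF : IsGermOfOrder m F) : IsGermOfOrder m (fun p => c * F p) := by
  simpa using (of_contDiff (contDiff_const (c := c))).mul hF

theorem pow (hF : IsGermOfOrder m F) (n : ℕ) : IsGermOfOrder (n * m) (fun p => F p ^ n) := by
  induction n with
  | zero => simpa using of_contDiff (contDiff_const (c := (1 : ℝ)))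
  | succ n ih => simpa [pow_succ, add_mul] using ih.mul hF

theorem zero : IsGermOfOrder m (fun _ => 0) :=
  ⟨Eventually.of_forall fun _ => contDiffAt_const, fun j _ => by
    rw [iteratedFDeriv_fun_zero]; rfl⟩

theorem sum {ι : Type*} (s : Finset ι) {F : ι → ℝ × ℝ → ℝ}
    (h : ∀ i ∈ s, IsGermOfOrder m (F i)) : IsGermOfOrder m (fun p => ∑ i ∈ s, F i p) := by
  classical
  induction s using Finset.induction_on with
  | empty => simpa using zero
  | insert i s hi ih =>
    simp only [Finset.sum_insert hi]
    exact (h i (by simp)).add (ih fun j hj => h j (by simp [hj]))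

theorem fderiv_apply (hF : IsGermOfOrder (m + 1) F) (w : ℝ × ℝ) :
    IsGermOfOrder m (fun p => fderiv ℝ F p w) := by
  have h : ∀ᶠ p in 𝓝 (0 : ℝ × ℝ), ContDiffAt ℝ ∞ (fderiv ℝ F) p := by
    filter_upwards [hF.1] with p hp using hp.fderiv_right (by simp)
  refine ⟨?_, fun j hj => ?_⟩
  · filter_upwards [h] with p hp using hp.clm_apply contDiffAt_const
  · have h1 := (ContinuousLinearMap.apply ℝ ℝ w).norm_iteratedFDeriv_comp_left (n := j)
      h.self_of_nhds (mod_cast le_top)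
    rw [norm_iteratedFDeriv_fderiv, hF.2 (j + 1) (by omega)] at h1
    exact norm_le_zero_iff.1 (h1.trans (by simp))

/-- Induction on the order: both partial derivatives are `O(‖p‖ ^ m)`, and the mean value inequality
on the ball of radius `‖p‖` gains one power. -/
theorem isBigO (hF : IsGermOfOrder m F) : F =O[𝓝 0] fun p => ‖p‖ ^ m := by
  induction m generalizing F with
  | zero => simpa using (hF.contDiffAt.continuousAt.isBigO_one ℝ)
  | succ m ih =>
    obtain ⟨C, hC⟩ := (ih (hF.fderiv_apply (1, 0))).bound
    obtain ⟨D, hD⟩ := (ih (hF.fderiv_apply (0, 1))).bound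
    obtain ⟨ε, hε, h⟩ := Metric.eventually_nhds_iff_ball.1 ((hC.and hD).and hF.1)
    refine IsBigO.of_bound (C + D) (Metric.eventually_nhds_iff_ball.2 ⟨ε, hε, fun p hp => ?_⟩)
    have hsub : Metric.closedBall (0 : ℝ × ℝ) ‖p‖ ⊆ Metric.ball 0 ε :=
      Metric.closedBall_subset_ball (by simpa using hp)
    have key := (convex_closedBall (0 : ℝ × ℝ) ‖p‖).norm_image_sub_le_of_norm_fderiv_le (𝕜 := ℝ)
      (f := F) (C := (C + D) * ‖p‖ ^ m) (x := 0) (y := p)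
      (fun x hx => (h x (hsub hx)).2.differentiableAt (by simp)) (fun x hx => ?_)
      (by simp) (by simp)
    · have h0 : F 0 = 0 := by simpa using congrArg (fun L => L ![]) (hF.2 0 (by omega))
      simpa [h0, pow_succ, mul_assoc] using key
    · obtain ⟨⟨h1, h2⟩, -⟩ := h x (hsub hx)
      have hxp : ‖x‖ ^ m ≤ ‖p‖ ^ m := by
        gcongr
        simpa using hx
      simp only [norm_pow, norm_norm] at h1 h2
      have hle : ‖fderiv ℝ F x‖ ≤ ‖fderiv ℝ F x (1, 0)‖ + ‖fderiv ℝ F x (0, 1)‖ := by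
        refine ContinuousLinearMap.opNorm_le_bound _ (by positivity) fun w => ?_
        have hw : w = w.1 • ((1 : ℝ), (0 : ℝ)) + w.2 • ((0 : ℝ), (1 : ℝ)) := by ext <;> simp
        calc ‖fderiv ℝ F x w‖
            = ‖w.1 • fderiv ℝ F x (1, 0) + w.2 • fderiv ℝ F x (0, 1)‖ := by
              conv_lhs => rw [hw, map_add, map_smul, map_smul]
          _ ≤ ‖w.1‖ * ‖fderiv ℝ F x (1, 0)‖ + ‖w.2‖ * ‖fderiv ℝ F x (0, 1)‖ := by
              refine (norm_add_le _ _).trans ?_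
              rw [norm_smul, norm_smul]
          _ ≤ ‖w‖ * ‖fderiv ℝ F x (1, 0)‖ + ‖w‖ * ‖fderiv ℝ F x (0, 1)‖ := by
              gcongr
              · exact norm_fst_le w
              · exact norm_snd_le w
          _ = _ := by ring
      -- The constants `C` and `D` are not known to be nonnegative. If `‖x‖ ^ m` vanishes, the
      -- bounds at `x` say nothing about their signs, and those at `p` are used instead.
      rcases eq_or_ne (‖x‖ ^ m) 0 with h0 | h0
      · rw [h0, mul_zero] at h1 h2
        have hp0 : 0 ≤ (C + D) * ‖p‖ ^ m := by
          by_contra! hneg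
          have := (h p (by simpa using hp)).1
          simp only [norm_pow, norm_norm] at this
          have h3 := (norm_nonneg _).trans this.1
          have h4 := (norm_nonneg _).trans this.2
          nlinarith
        linarith
      · have hpos : 0 < ‖x‖ ^ m := lt_of_le_of_ne (by positivity) h0.symm
        have hCD : 0 ≤ C + D := by
          have h3 := nonneg_of_mul_nonneg_left ((norm_nonneg _).trans h1) hpos
          have h4 := nonneg_of_mul_nonneg_left ((norm_nonneg _).trans h2) hpos
          linarith
        nlinarith [mul_le_mul_of_nonneg_left hxp hCD]

end IsGermOfOrder

/-! ### Angular derivative and polar coordinates -/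

/-- The derivative of `F` along the rotation field, that is, `∂F/∂θ` in polar coordinates. -/
noncomputable def angularDeriv (F : ℝ × ℝ → ℝ) (p : ℝ × ℝ) : ℝ := fderiv ℝ F p (-p.2, p.1)

/-- Differentiation costs one order, and the coefficients `-v` and `u` of the rotation field give it
back. So the derivative can be iterated without loss. -/
theorem IsGermOfOrder.angularDeriv {m : ℕ} {F : ℝ × ℝ → ℝ} (hF : IsGermOfOrder (m + 1) F) :
    IsGermOfOrder (m + 1) (angularDeriv F) := by
  have h : _root_.angularDeriv F = fun p => (-1) * (fderiv ℝ F p (1, 0) * p.2)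
      + fderiv ℝ F p (0, 1) * p.1 := by
    funext p
    have hw : (-p.2, p.1) = (-p.2) • ((1 : ℝ), (0 : ℝ)) + p.1 • ((0 : ℝ), (1 : ℝ)) := by
      ext <;> simp
    rw [_root_.angularDeriv, hw, map_add, map_smul, map_smul, smul_eq_mul, smul_eq_mul]
    ring
  rw [h]
  exact (((hF.fderiv_apply _).mul .snd).const_mul _).add ((hF.fderiv_apply _).mul .fst)

theorem hasDerivAt_polarPt (r θ : ℝ) :
    HasDerivAt (polarPt r) (-(polarPt r θ).2, (polarPt r θ).1) θ := by
  have h := ((Real.hasDerivAt_cos θ).const_mul r).prodMk ((Real.hasDerivAt_sin θ).const_mul r)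
  convert h using 2 <;> simp [polarPt]

theorem hasDerivAt_comp_polarPt {F : ℝ × ℝ → ℝ} {r θ : ℝ}
    (hF : DifferentiableAt ℝ F (polarPt r θ)) :
    HasDerivAt (fun t => F (polarPt r t)) (angularDeriv F (polarPt r θ)) θ :=
  hF.hasFDerivAt.comp_hasDerivAt θ (hasDerivAt_polarPt r θ)

theorem norm_polarPt_le (r θ : ℝ) : ‖polarPt r θ‖ ≤ |r| := by
  refine max_le ?_ ?_ <;> simp only [polarPt, Real.norm_eq_abs, abs_mul]
  · exact mul_le_of_le_one_right (abs_nonneg r) (Real.abs_cos_le_one θ)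
  · exact mul_le_of_le_one_right (abs_nonneg r) (Real.abs_sin_le_one θ)

/-- The radius is uniform in the angle, as a frame must be differentiable along a whole circle. -/
theorem exists_forall_polarPt {P : ℝ × ℝ → Prop} (h : ∀ᶠ p in 𝓝 0, P p) :
    ∃ ρ : ℝ, 0 < ρ ∧ ∀ r, 0 < r → r < ρ → ∀ θ, P (polarPt r θ) := by
  obtain ⟨ε, hε, h⟩ := Metric.eventually_nhds_iff_ball.1 h
  refine ⟨ε, hε, fun r hr hrε θ => h _ ?_⟩
  simpa using (norm_polarPt_le r θ).trans_lt (by rwa [abs_of_pos hr])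

theorem IsGermOfOrder.isBigO_polarPt {m : ℕ} {F : ℝ × ℝ → ℝ} (hF : IsGermOfOrder m F) (θ : ℝ) :
    (fun r => F (polarPt r θ)) =O[𝓝[>] 0] fun r : ℝ => r ^ m := by
  have ht : Tendsto (fun r => polarPt r θ) (𝓝[>] 0) (𝓝 0) := by
    have hc : Continuous fun r => polarPt r θ := by
      unfold polarPt
      fun_prop
    have := hc.tendsto 0
    rw [show polarPt 0 θ = 0 by simp [polarPt]] at this
    exact this.mono_left nhdsWithin_le_nhds
  refine (hF.isBigO.comp_tendsto ht).trans (IsBigO.of_bound 1 (Eventually.of_forall fun r => ?_))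
  simp only [Function.comp_apply, norm_pow, norm_norm, one_mul]
  gcongr
  exact norm_polarPt_le r θ

/-! ### Arithmetic of leading terms in the radius -/

/-- `A r = c r ^ m + O(r ^ (m + 1))` as `r → +0`. -/
def HasLeadingTerm (m : ℕ) (A : ℝ → ℝ) (c : ℝ) : Prop :=
  (fun r => A r - c * r ^ m) =O[𝓝[>] 0] fun r : ℝ => r ^ (m + 1)

theorem isBigO_pow_pow_of_le {m n : ℕ} (h : m ≤ n) :
    (fun r : ℝ => r ^ n) =O[𝓝[>] 0] fun r : ℝ => r ^ m := by
  obtain ⟨d, rfl⟩ := Nat.exists_eq_add_of_le h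
  simp only [pow_add]
  have : (fun r : ℝ => r ^ d) =O[𝓝[>] 0] fun _ => (1 : ℝ) :=
    ((continuous_pow d).tendsto 0).mono_left nhdsWithin_le_nhds |>.isBigO_one ℝ
  simpa using (isBigO_refl (fun r : ℝ => r ^ m) _).mul this

namespace HasLeadingTerm

variable {m n : ℕ} {A B : ℝ → ℝ} {c d : ℝ}

theorem of_isBigO (h : A =O[𝓝[>] 0] fun r : ℝ => r ^ (m + 1)) : HasLeadingTerm m A 0 := by
  simpa [HasLeadingTerm] using h

theorem const_mul_pow (m : ℕ) (c : ℝ) : HasLeadingTerm m (fun r => c * r ^ m) c := by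
  simp [HasLeadingTerm, isBigO_zero]

theorem isBigO (h : HasLeadingTerm m A c) : A =O[𝓝[>] 0] fun r : ℝ => r ^ m := by
  have := (h.trans (isBigO_pow_pow_of_le m.le_succ)).add
    ((isBigO_refl (fun r : ℝ => r ^ m) (𝓝[>] 0)).const_mul_left c)
  simpa using this

/-- Lets a term of higher order enter a sum at a lower order with coefficient zero. -/
theorem of_lt (h : HasLeadingTerm n A c) (hmn : m < n) : HasLeadingTerm m A 0 :=
  of_isBigO (h.isBigO.trans (isBigO_pow_pow_of_le hmn))

theorem add (hA : HasLeadingTerm m A c) (hB : HasLeadingTerm m B d) :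
    HasLeadingTerm m (fun r => A r + B r) (c + d) :=
  (IsBigO.add hA hB).congr_left fun r => by ring

theorem neg (hA : HasLeadingTerm m A c) : HasLeadingTerm m (fun r => -A r) (-c) :=
  (IsBigO.neg_left hA).congr_left fun r => by ring

theorem sub (hA : HasLeadingTerm m A c) (hB : HasLeadingTerm m B d) :
    HasLeadingTerm m (fun r => A r - B r) (c - d) :=
  (IsBigO.sub hA hB).congr_left fun r => by ring

theorem mul (hA : HasLeadingTerm m A c) (hB : HasLeadingTerm n B d) :
    HasLeadingTerm (m + n) (fun r => A r * B r) (c * d) := by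
  have h1 := IsBigO.mul hA hB.isBigO
  have h2 := IsBigO.mul (const_mul_pow m c).isBigO hB
  refine ((h1.congr_right fun r => ?_).add (h2.congr_right fun r => ?_)).congr_left fun r => ?_
  · ring
  · ring
  · ring

theorem congr (hA : HasLeadingTerm m A c) (h : A =ᶠ[𝓝[>] 0] B) (hcd : c = d) :
    HasLeadingTerm m B d := by
  subst hcd
  exact IsBigO.congr' hA (h.mono fun r hr => by simp only [hr]) EventuallyEq.rfl

theorem div_pow (hA : HasLeadingTerm (m + n) A c) : HasLeadingTerm m (fun r => A r / r ^ n) c := by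
  have h := IsBigO.mul hA (isBigO_refl (fun r : ℝ => (r ^ n)⁻¹) (𝓝[>] 0))
  refine h.congr' ?_ ?_ <;> filter_upwards [self_mem_nhdsWithin] with r hr
  · have hr : r ≠ 0 := ne_of_gt hr
    field_simp
    ring
  · have hr : r ≠ 0 := ne_of_gt hr
    field_simp
    ring

theorem tendsto (hA : HasLeadingTerm 0 A c) : Tendsto A (𝓝[>] 0) (𝓝 c) := by
  have h0 : Tendsto (fun r : ℝ => r ^ (0 + 1)) (𝓝[>] 0) (𝓝 0) := by
    have := ((continuous_pow (0 + 1)).tendsto (0 : ℝ)).mono_left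
      (nhdsWithin_le_nhds (s := Set.Ioi 0))
    simpa using this
  have := (IsBigO.trans_tendsto hA h0).add_const c
  simpa using this

theorem eq (hc : HasLeadingTerm m A c) (hd : HasLeadingTerm m A d) : c = d := by
  have h (e : ℝ) (he : HasLeadingTerm m A e) : Tendsto (fun r => A r / r ^ m) (𝓝[>] 0) (𝓝 e) :=
    (div_pow (m := 0) (by simpa using he)).tendsto
  exact tendsto_nhds_unique (h c hc) (h d hd)

theorem eventually_ne (hA : HasLeadingTerm m A c) (hc : c ≠ 0) : ∀ᶠ r in 𝓝[>] 0, A r ≠ 0 := by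
  have h : Tendsto (fun r => A r / r ^ m) (𝓝[>] 0) (𝓝 c) :=
    (div_pow (m := 0) (by simpa using hA)).tendsto
  filter_upwards [h.eventually_ne hc] with r hr h0
  simp [h0] at hr

theorem inv (hA : HasLeadingTerm 0 A c) (hc : c ≠ 0) : HasLeadingTerm 0 (fun r => (A r)⁻¹) c⁻¹ := by
  have hinv : (fun r => (A r)⁻¹) =O[𝓝[>] 0] fun _ => (1 : ℝ) :=
    (hA.tendsto.inv₀ hc).isBigO_one ℝ
  refine ((IsBigO.mul hA hinv).const_mul_left (-c⁻¹)).congr' ?_ ?_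
  · filter_upwards [hA.eventually_ne hc] with r hr
    field_simp
    ring
  · exact Eventually.of_forall fun r => by simp

theorem sqrt (hA : HasLeadingTerm 0 A c) (hc : 0 < c) :
    HasLeadingTerm 0 (fun r => √(A r)) √c := by
  refine IsBigO.trans (IsBigO.of_bound (√c)⁻¹ ?_) hA
  filter_upwards [hA.tendsto.eventually (eventually_gt_nhds hc)] with r hr
  have h1 : A r - c = (√(A r) - √c) * (√(A r) + √c) := by
    nlinarith [Real.sq_sqrt hr.le, Real.sq_sqrt hc.le]
  have hs : 0 < √c := Real.sqrt_pos.2 hc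
  simp only [pow_zero, mul_one]
  rw [h1, norm_mul, Real.norm_of_nonneg (by positivity : 0 ≤ √(A r) + √c), inv_mul_eq_div,
    le_div_iff₀ hs]
  gcongr
  linarith [Real.sqrt_nonneg (A r)]

end HasLeadingTerm

theorem IsGermOfOrder.hasLeadingTerm {m : ℕ} {F : ℝ × ℝ → ℝ} (hF : IsGermOfOrder (m + 1) F)
    (θ : ℝ) : HasLeadingTerm m (fun r => F (polarPt r θ)) 0 :=
  .of_isBigO (hF.isBigO_polarPt θ)

/-- Two expansions must start at the same exponent: otherwise the one with the smaller exponent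
would have zero coefficient at every angle, contrary to its being not identically zero. Coefficients
then agree pointwise, and the factors without zeros do not affect vanishing. -/
theorem isFirstTerm_iff_of_hasLeadingTerm {x : ℝ → ℝ → ℝ} {S : Set ℝ} {m : ℕ} {y z : ℝ → ℝ}
    (hy : ∃ θ ∈ S, y θ ≠ 0) (hz : ∀ θ ∈ S, z θ ≠ 0)
    (hx : ∀ θ ∈ S, HasLeadingTerm m (fun r => x r θ) (y θ * z θ)) :
    IsFirstTerm x S y ∧ ∀ c, IsFirstTerm x S c → ∀ θ ∈ S, c θ = 0 ↔ y θ = 0 := by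
  refine ⟨⟨hy, m, z, hz, hx⟩, fun c ⟨⟨θ₁, hθ₁, hc₁⟩, i, x₀, hx₀, h⟩ θ hθ => ?_⟩
  replace h : ∀ θ ∈ S, HasLeadingTerm i (fun r => x r θ) (c θ * x₀ θ) := h
  obtain ⟨θ₂, hθ₂, hy₂⟩ := hy
  obtain rfl : i = m := by
    rcases lt_trichotomy i m with him | him | him
    · have := (h θ₁ hθ₁).eq ((hx θ₁ hθ₁).of_lt him)
      simp [hc₁, hx₀ θ₁ hθ₁] at this
    · exact him
    · have := (hx θ₂ hθ₂).eq ((h θ₂ hθ₂).of_lt him)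
      simp [hy₂, hz θ₂ hθ₂] at this
  have := (h θ hθ).eq (hx θ hθ)
  constructor <;> intro h0 <;> simp [h0, hx₀ θ hθ, hz θ hθ] at this <;> exact this

/-! ### Vector calculus and frames along a curve -/

section VectorCalculus

variable {x y : ℝ → Fin 3 → ℝ} {x' y' : Fin 3 → ℝ} {t : ℝ}

theorem HasDerivAt.dotProduct_fin_three (hx : HasDerivAt x x' t) (hy : HasDerivAt y y' t) :
    HasDerivAt (fun s => x s ⬝ᵥ y s) (x' ⬝ᵥ y t + x t ⬝ᵥ y') t := by
  rw [hasDerivAt_pi] at hx hy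
  simp only [Matrix.vec3_dotProduct]
  exact ((((hx 0).mul (hy 0)).add ((hx 1).mul (hy 1))).add ((hx 2).mul (hy 2))).congr_deriv
    (by ring)

theorem HasDerivAt.crossProduct (hx : HasDerivAt x x' t) (hy : HasDerivAt y y' t) :
    HasDerivAt (fun s => x s ⨯₃ y s) (x' ⨯₃ y t + x t ⨯₃ y') t := by
  rw [hasDerivAt_pi] at *
  simp only [cross_apply, Fin.forall_fin_succ, IsEmpty.forall_iff, and_true, Pi.add_apply]
  refine ⟨?_, ?_, ?_⟩
  · exact (((hx 1).mul (hy 2)).sub ((hx 2).mul (hy 1))).congr_deriv (by simp; ring)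
  · exact (((hx 2).mul (hy 0)).sub ((hx 0).mul (hy 2))).congr_deriv (by simp; ring)
  · exact (((hx 0).mul (hy 1)).sub ((hx 1).mul (hy 0))).congr_deriv (by simp; ring)

theorem orthonormal_expansion {e b n : Fin 3 → ℝ} (hee : e ⬝ᵥ e = 1) (hbb : b ⬝ᵥ b = 1)
    (hnn : n ⬝ᵥ n = 1) (heb : e ⬝ᵥ b = 0) (hen : e ⬝ᵥ n = 0) (hbn : b ⬝ᵥ n = 0)
    (w : Fin 3 → ℝ) : w = (w ⬝ᵥ e) • e + (w ⬝ᵥ b) • b + (w ⬝ᵥ n) • n := by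
  have h : Matrix.of ![e, b, n] * (Matrix.of ![e, b, n])ᵀ = 1 := by
    have hbe : b ⬝ᵥ e = 0 := by rw [dotProduct_comm, heb]
    have hne : n ⬝ᵥ e = 0 := by rw [dotProduct_comm, hen]
    have hnb : n ⬝ᵥ b = 0 := by rw [dotProduct_comm, hbn]
    ext i j
    change ![e, b, n] i ⬝ᵥ ![e, b, n] j = _
    fin_cases i <;> fin_cases j <;> simp [hee, hbb, hnn, heb, hen, hbn, hbe, hne, hnb]
  -- The matrix with rows `e`, `b`, `n` has its transpose as right inverse, hence also as left
  -- inverse; applying the latter identity to `w` is the expansion.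
  have h2 := congrArg (fun M => w ᵥ* M) (mul_eq_one_comm.1 h)
  simp only [Matrix.vecMul_one] at h2
  conv_lhs => rw [← h2]
  ext i
  simp [Matrix.vecMul, Matrix.mul_apply, dotProduct, Fin.sum_univ_three]
  ring

end VectorCalculus

/-- Differentiating `T = l e` gives `X · n = l κ₂`, while `T × ν = -l n`. The product contains `l² =
T · T`, so no sign of `l` survives. -/
theorem IsFrenetFrame.kappa_two_mul {γ : ℝ → Fin 3 → ℝ} {l : ℝ → ℝ} {e b n : ℝ → Fin 3 → ℝ}
    {κ₁ κ₂ κ₃ : ℝ → ℝ} (h : IsFrenetFrame γ l e b n κ₁ κ₂ κ₃) {T : ℝ → Fin 3 → ℝ}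
    {X ν : Fin 3 → ℝ} {t : ℝ} (hT : ∀ s, HasDerivAt γ (T s) s) (hX : HasDerivAt T X t)
    (hn : n t = -(e t ⨯₃ ν)) : κ₂ t * (T t ⬝ᵥ T t) = -(X ⬝ᵥ T t ⨯₃ ν) := by
  have hle : ∀ s, T s = l s • e s := fun s => (hT s).unique (h.tangent s)
  have hl : ∀ s, l s = T s ⬝ᵥ e s := fun s => by simp [hle, h.unit_e]
  have hl' := (hX.dotProduct_fin_three (h.deriv_e t)).congr_of_eventuallyEq
    (Eventually.of_forall hl)
  have hX' : X = _ := hX.unique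
    ((hl'.smul (h.deriv_e t)).congr_of_eventuallyEq (Eventually.of_forall hle))
  have hbn : b t ⬝ᵥ n t = 0 := by rw [h.b_eq, neg_dotProduct, dotProduct_comm, dot_cross_self, neg_zero]
  have hXn : X ⬝ᵥ n t = l t * κ₂ t := by
    rw [hX']
    simp [add_dotProduct, h.orth, h.unit_n, hbn]
  have hTn : T t ⨯₃ ν = -(l t • n t) := by rw [hle, hn, smul_neg, neg_neg, LinearMap.map_smul₂]
  rw [hTn, dotProduct_neg, dotProduct_smul, hXn, hle t]
  simp [h.unit_e]
  ring

/-- Normalise `T` to get `e`, then take cross products. The frame equations are orthonormal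
expansions whose coefficients are skew-symmetric, because the inner products of the frame are
constant. -/
theorem exists_frenetFrame {γ T ν : ℝ → Fin 3 → ℝ} (hγ : ∀ t, HasDerivAt γ (T t) t)
    (hT : Differentiable ℝ T) (hν : Differentiable ℝ ν) (hT0 : ∀ t, T t ⬝ᵥ T t ≠ 0)
    (hν1 : ∀ t, ν t ⬝ᵥ ν t = 1) (hTν : ∀ t, T t ⬝ᵥ ν t = 0) :
    ∃ (l : ℝ → ℝ) (e b n : ℝ → Fin 3 → ℝ) (κ₁ κ₂ κ₃ : ℝ → ℝ),
      IsFrenetFrame γ l e b n κ₁ κ₂ κ₃ ∧ ∀ t, n t = -(e t ⨯₃ ν t) := by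
  have hpos : ∀ t, 0 < T t ⬝ᵥ T t := fun t =>
    lt_of_le_of_ne (by simpa using dotProduct_star_self_nonneg (T t)) (hT0 t).symm
  have hl0 : ∀ t, √(T t ⬝ᵥ T t) ≠ 0 := fun t => (Real.sqrt_pos.2 (hpos t)).ne'
  obtain ⟨e, he⟩ : ∃ e : ℝ → Fin 3 → ℝ, e = fun t => (√(T t ⬝ᵥ T t))⁻¹ • T t := ⟨_, rfl⟩
  have hde : Differentiable ℝ e := fun t => by
    have h1 := ((hT t).hasDerivAt.dotProduct_fin_three (hT t).hasDerivAt).differentiableAt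
    rw [he]
    exact ((h1.sqrt (hT0 t)).inv (hl0 t)).smul (hT t)
  have hee : ∀ t, e t ⬝ᵥ e t = 1 := fun t => by
    have := Real.mul_self_sqrt (hpos t).le
    have := hl0 t
    simp only [he, smul_dotProduct, dotProduct_smul, smul_eq_mul]
    field_simp
    nlinarith
  have heν : ∀ t, e t ⬝ᵥ ν t = 0 := fun t => by simp [he, hTν]
  obtain ⟨n, hn⟩ : ∃ n : ℝ → Fin 3 → ℝ, n = fun t => -(e t ⨯₃ ν t) := ⟨_, rfl⟩
  have hdn : Differentiable ℝ n := fun t => by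
    rw [hn]
    exact ((hde t).hasDerivAt.crossProduct (hν t).hasDerivAt).differentiableAt.neg
  have hnn : ∀ t, n t ⬝ᵥ n t = 1 := fun t => by
    simp [hn, cross_dot_cross, hee, hν1, heν]
  have hen : ∀ t, e t ⬝ᵥ n t = 0 := fun t => by simp [hn]
  obtain ⟨b, hb⟩ : ∃ b : ℝ → Fin 3 → ℝ, b = fun t => -(e t ⨯₃ n t) := ⟨_, rfl⟩
  have hdb : Differentiable ℝ b := fun t => by
    rw [hb]
    exact ((hde t).hasDerivAt.crossProduct (hdn t).hasDerivAt).differentiableAt.neg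
  have hbb : ∀ t, b t ⬝ᵥ b t = 1 := fun t => by
    simp [hb, cross_dot_cross, hee, hnn, hen]
  have hbe : ∀ t, b t ⬝ᵥ e t = 0 := fun t => by
    rw [dotProduct_comm]; simp [hb]
  have hbn : ∀ t, b t ⬝ᵥ n t = 0 := fun t => by
    rw [dotProduct_comm]; simp [hb]
  have hexp : ∀ t w, w = (w ⬝ᵥ e t) • e t + (w ⬝ᵥ b t) • b t + (w ⬝ᵥ n t) • n t := fun t =>
    orthonormal_expansion (hee t) (hbb t) (hnn t) (dotProduct_comm (e t) _ ▸ hbe t) (hen t) (hbn t)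
  have hconst : ∀ {x y : ℝ → Fin 3 → ℝ} (c : ℝ), Differentiable ℝ x → Differentiable ℝ y →
      (∀ t, x t ⬝ᵥ y t = c) → ∀ t, deriv x t ⬝ᵥ y t = -(deriv y t ⬝ᵥ x t) := by
    intro x y c hx hy hxy t
    have h1 := (hx t).hasDerivAt.dotProduct_fin_three (hy t).hasDerivAt
    have h2 := h1.unique ((hasDerivAt_const t c).congr_of_eventuallyEq (Eventually.of_forall hxy))
    rw [dotProduct_comm (x t)] at h2
    linarith
  refine ⟨fun t => √(T t ⬝ᵥ T t), e, b, n, fun t => deriv e t ⬝ᵥ b t, fun t => deriv e t ⬝ᵥ n t,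
    fun t => deriv b t ⬝ᵥ n t, ⟨fun t => ?_, hee, hnn, hen, fun t => by rw [hb], fun t => ?_,
    fun t => ?_, fun t => ?_⟩, fun t => by rw [hn]⟩
  · convert hγ t using 1
    rw [he, smul_smul, mul_inv_cancel₀ (hl0 t), one_smul]
  · refine (hde t).hasDerivAt.congr_deriv ?_
    have := hconst 1 hde hde hee t
    conv_lhs => rw [hexp t (deriv e t), show deriv e t ⬝ᵥ e t = 0 by linarith]
    simp
  · refine (hdb t).hasDerivAt.congr_deriv ?_
    have := hconst 1 hdb hdb hbb t
    conv_lhs => rw [hexp t (deriv b t), show deriv b t ⬝ᵥ b t = 0 by linarith,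
      hconst 0 hdb hde hbe t]
    simp
  · refine (hdn t).hasDerivAt.congr_deriv ?_
    have := hconst 1 hdn hdn hnn t
    conv_lhs => rw [hexp t (deriv n t), show deriv n t ⬝ᵥ n t = 0 by linarith,
      ← neg_eq_iff_eq_neg.2 (hconst 0 hdb hdn hbn t), ← neg_eq_iff_eq_neg.2 (hconst 0 hde hdn hen t)]
    simp [sub_eq_add_neg]

/-! ### The umbrella with third-order remainders -/

/-- The umbrella `(u, u v + F, α u² / 2 + β u v + γ v² / 2 + G)`. -/
noncomputable def umbrella (α β γ : ℝ) (F G : ℝ × ℝ → ℝ) (p : ℝ × ℝ) : Fin 3 → ℝ :=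
  ![p.1, p.1 * p.2 + F p,
    α / 2 * p.1 ^ 2 + β * (p.1 * p.2) + γ / 2 * p.2 ^ 2 + G p]

/-- The first derivative of `umbrella α β γ F G` along circles. -/
noncomputable def umbrellaVelocity (α β γ : ℝ) (F G : ℝ × ℝ → ℝ) (p : ℝ × ℝ) : Fin 3 → ℝ :=
  ![-p.2, p.1 * p.1 - p.2 * p.2 + angularDeriv F p,
    (γ - α) * (p.1 * p.2) + β * (p.1 * p.1 - p.2 * p.2) + angularDeriv G p]

/-- The second derivative of `umbrella α β γ F G` along circles. -/
noncomputable def umbrellaAcceleration (α β γ : ℝ) (F G : ℝ × ℝ → ℝ) (p : ℝ × ℝ) : Fin 3 → ℝ :=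
  ![-p.1, -4 * (p.1 * p.2) + angularDeriv (angularDeriv F) p,
    (γ - α) * (p.1 * p.1 - p.2 * p.2) + (-4 * β) * (p.1 * p.2)
      + angularDeriv (angularDeriv G) p]

/-- The cross product of the partial derivatives of `umbrella α β γ F G`. -/
noncomputable def umbrellaNormal (α β γ : ℝ) (F G : ℝ × ℝ → ℝ) (p : ℝ × ℝ) : Fin 3 → ℝ :=
  ![(p.2 + fderiv ℝ F p (1, 0)) * (β * p.1 + γ * p.2 + fderiv ℝ G p (0, 1))
      - (α * p.1 + β * p.2 + fderiv ℝ G p (1, 0)) * (p.1 + fderiv ℝ F p (0, 1)),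
    -(β * p.1 + γ * p.2 + fderiv ℝ G p (0, 1)),
    p.1 + fderiv ℝ F p (0, 1)]

/-- The derivatives of `F` occurring in the frame equations are differentiable at `p`. -/
structure IsRegularAt (F : ℝ × ℝ → ℝ) (p : ℝ × ℝ) : Prop where
  self : DifferentiableAt ℝ F p
  angular : DifferentiableAt ℝ (angularDeriv F) p
  partial_fst : DifferentiableAt ℝ (fun q => fderiv ℝ F q (1, 0)) p
  partial_snd : DifferentiableAt ℝ (fun q => fderiv ℝ F q (0, 1)) p

theorem IsGermOfOrder.eventually_isRegularAt {m : ℕ} {F : ℝ × ℝ → ℝ}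
    (hF : IsGermOfOrder (m + 1) F) : ∀ᶠ p in 𝓝 0, IsRegularAt F p := by
  filter_upwards [hF.1, hF.angularDeriv.1, (hF.fderiv_apply (1, 0)).1, (hF.fderiv_apply (0, 1)).1]
    with p h₁ h₂ h₃ h₄
  exact ⟨h₁.differentiableAt (by simp), h₂.differentiableAt (by simp),
    h₃.differentiableAt (by simp), h₄.differentiableAt (by simp)⟩

section Umbrella

variable {α β γ : ℝ} {F G : ℝ × ℝ → ℝ} {r θ : ℝ}

theorem fderiv_umbrella {p : ℝ × ℝ} (hF : DifferentiableAt ℝ F p) (hG : DifferentiableAt ℝ G p)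
    (w : ℝ × ℝ) : fderiv ℝ (umbrella α β γ F G) p w =
      ![w.1, p.1 * w.2 + p.2 * w.1 + fderiv ℝ F p w,
        (α * p.1 + β * p.2) * w.1 + (β * p.1 + γ * p.2) * w.2 + fderiv ℝ G p w] := by
  have h1 : HasFDerivAt (fun q : ℝ × ℝ => q.1) (ContinuousLinearMap.fst ℝ ℝ ℝ) p := hasFDerivAt_fst
  have h2 : HasFDerivAt (fun q : ℝ × ℝ => q.2) (ContinuousLinearMap.snd ℝ ℝ ℝ) p := hasFDerivAt_snd
  have key {f g : ℝ × ℝ → ℝ} {f' g' : ℝ × ℝ →L[ℝ] ℝ} (hf : HasFDerivAt f f' p)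
      (hg : HasFDerivAt g g' p) : HasFDerivAt (fun q => ![q.1, f q, g q])
        (ContinuousLinearMap.pi ![ContinuousLinearMap.fst ℝ ℝ ℝ, f', g']) p := by
    rw [hasFDerivAt_pi']
    simp only [Fin.forall_fin_succ, IsEmpty.forall_iff, and_true]
    exact ⟨h1, hf, hg⟩
  have h : HasFDerivAt (umbrella α β γ F G) _ p := key ((h1.mul h2).add hF.hasFDerivAt)
    (((((h1.pow 2).const_mul (α / 2)).add ((h1.mul h2).const_mul β)).add
      ((h2.pow 2).const_mul (γ / 2))).add hG.hasFDerivAt)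
  rw [h.fderiv]
  ext i
  fin_cases i
  · simp
  · simp
  · simp
    ring

theorem normalVec_umbrella {p : ℝ × ℝ} (hF : DifferentiableAt ℝ F p)
    (hG : DifferentiableAt ℝ G p) :
    normalVec (umbrella α β γ F G) p = umbrellaNormal α β γ F G p := by
  rw [normalVec, fderiv_umbrella hF hG, fderiv_umbrella hF hG, cross_apply]
  simp [umbrellaNormal]

/-- The velocity is `-v f_u + u f_v`, a tangent vector of the surface. -/
theorem umbrellaVelocity_dotProduct_umbrellaNormal (p : ℝ × ℝ) :
    umbrellaVelocity α β γ F G p ⬝ᵥ umbrellaNormal α β γ F G p = 0 := by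
  have h (F : ℝ × ℝ → ℝ) : angularDeriv F p
      = -p.2 * fderiv ℝ F p (1, 0) + p.1 * fderiv ℝ F p (0, 1) := by
    have hw : (-p.2, p.1) = (-p.2) • ((1 : ℝ), (0 : ℝ)) + p.1 • ((0 : ℝ), (1 : ℝ)) := by
      ext <;> simp
    rw [angularDeriv, hw, map_add, map_smul, map_smul, smul_eq_mul, smul_eq_mul]
  simp [umbrellaVelocity, umbrellaNormal, h]
  ring

theorem hasDerivAt_polarPt_fst (r θ : ℝ) :
    HasDerivAt (fun t => (polarPt r t).1) (-(polarPt r θ).2) θ :=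
  ((hasFDerivAt_fst (p := polarPt r θ)).comp_hasDerivAt θ (hasDerivAt_polarPt r θ) :)

theorem hasDerivAt_polarPt_snd (r θ : ℝ) :
    HasDerivAt (fun t => (polarPt r t).2) (polarPt r θ).1 θ :=
  ((hasFDerivAt_snd (p := polarPt r θ)).comp_hasDerivAt θ (hasDerivAt_polarPt r θ) :)

theorem hasDerivAt_umbrella_polarPt (hF : DifferentiableAt ℝ F (polarPt r θ))
    (hG : DifferentiableAt ℝ G (polarPt r θ)) :
    HasDerivAt (fun t => umbrella α β γ F G (polarPt r t))
      (umbrellaVelocity α β γ F G (polarPt r θ)) θ := by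
  have h1 := hasDerivAt_polarPt_fst r θ
  have h2 := hasDerivAt_polarPt_snd r θ
  rw [hasDerivAt_pi]
  simp only [Fin.forall_fin_succ, IsEmpty.forall_iff, and_true]
  refine ⟨h1, ((h1.mul h2).add (hasDerivAt_comp_polarPt hF)).congr_deriv ?_,
    (((((h1.pow 2).const_mul (α / 2)).add ((h1.mul h2).const_mul β)).add
      ((h2.pow 2).const_mul (γ / 2))).add (hasDerivAt_comp_polarPt hG)).congr_deriv ?_⟩
  · simp [umbrellaVelocity]
    ring
  · simp [umbrellaVelocity]
    ring

theorem hasDerivAt_umbrellaVelocity_polarPt (hF : DifferentiableAt ℝ (angularDeriv F) (polarPt r θ))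
    (hG : DifferentiableAt ℝ (angularDeriv G) (polarPt r θ)) :
    HasDerivAt (fun t => umbrellaVelocity α β γ F G (polarPt r t))
      (umbrellaAcceleration α β γ F G (polarPt r θ)) θ := by
  have h1 := hasDerivAt_polarPt_fst r θ
  have h2 := hasDerivAt_polarPt_snd r θ
  rw [hasDerivAt_pi]
  simp only [Fin.forall_fin_succ, IsEmpty.forall_iff, and_true]
  refine ⟨h2.neg, (((h1.mul h1).sub (h2.mul h2)).add (hasDerivAt_comp_polarPt hF)).congr_deriv ?_,
    ((((h1.mul h2).const_mul (γ - α)).add (((h1.mul h1).sub (h2.mul h2)).const_mul β)).add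
      (hasDerivAt_comp_polarPt hG)).congr_deriv ?_⟩
  · simp [umbrellaAcceleration]
    ring
  · simp [umbrellaAcceleration]
    ring

theorem differentiableAt_umbrellaNormal_polarPt (hF : IsRegularAt F (polarPt r θ))
    (hG : IsRegularAt G (polarPt r θ)) :
    DifferentiableAt ℝ (fun t => umbrellaNormal α β γ F G (polarPt r t)) θ := by
  have h1 := (hasDerivAt_polarPt_fst r θ).differentiableAt
  have h2 := (hasDerivAt_polarPt_snd r θ).differentiableAt
  have hFu := (hasDerivAt_comp_polarPt hF.partial_fst).differentiableAt
  have hFv := (hasDerivAt_comp_polarPt hF.partial_snd).differentiableAt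
  have hGu := (hasDerivAt_comp_polarPt hG.partial_fst).differentiableAt
  have hGv := (hasDerivAt_comp_polarPt hG.partial_snd).differentiableAt
  rw [differentiableAt_pi]
  simp only [Fin.forall_fin_succ, IsEmpty.forall_iff, and_true, umbrellaNormal, Matrix.cons_val_zero,
    Matrix.cons_val_succ]
  exact ⟨((h2.add hFu).mul (((h1.const_mul β).add (h2.const_mul γ)).add hGv)).sub
      ((((h1.const_mul α).add (h2.const_mul β)).add hGu).mul (h1.add hFv)),
    (((h1.const_mul β).add (h2.const_mul γ)).add hGv).neg, h1.add hFv⟩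

/-- If the velocity vanishes, its first entry gives `v = 0` and its second gives `u² = O(|u|³)`,
impossible near the origin. -/
theorem eventually_umbrellaVelocity_ne_zero (hF : IsGermOfOrder 3 F) :
    ∀ᶠ p in 𝓝 0, p ≠ 0 → umbrellaVelocity α β γ F G p ≠ 0 := by
  obtain ⟨C, hC, h⟩ := hF.angularDeriv.isBigO.exists_pos
  filter_upwards [h.bound, Metric.ball_mem_nhds 0 (inv_pos.2 hC)] with p hp hball hp0 h0
  have hv : p.2 = 0 := by simpa [umbrellaVelocity] using congrFun h0 0
  have h1 : p.1 * p.1 - p.2 * p.2 + angularDeriv F p = 0 := congrFun h0 1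
  have hn : ‖p‖ = |p.1| := by simp [Prod.norm_def, hv]
  have hpos : 0 < ‖p‖ := norm_pos_iff.2 hp0
  have hlt : ‖p‖ < C⁻¹ := by simpa using hball
  rw [← one_div, lt_div_iff₀' hC] at hlt
  simp only [norm_pow, norm_norm] at hp
  rw [Real.norm_eq_abs] at hp
  have h2 : angularDeriv F p = -‖p‖ ^ 2 := by
    rw [hn, sq_abs]
    rw [hv] at h1
    linarith
  rw [h2, abs_neg, abs_of_nonneg (by positivity)] at hp
  rw [pow_succ ‖p‖ 2] at hp
  nlinarith [mul_lt_mul_of_pos_right hlt (pow_pos hpos 2)]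

/-- If the normal vanishes, its last entry gives `u = O(‖p‖²)`, and then its middle entry gives `v =
O(‖p‖²)` because `γ > 0`. So `‖p‖ = O(‖p‖²)`, impossible near the origin. -/
theorem eventually_umbrellaNormal_ne_zero (hγ : 0 < γ) (hF : IsGermOfOrder 3 F)
    (hG : IsGermOfOrder 3 G) : ∀ᶠ p in 𝓝 0, p ≠ 0 → umbrellaNormal α β γ F G p ≠ 0 := by
  obtain ⟨C, hC, h⟩ := (hF.fderiv_apply (0, 1)).isBigO.exists_pos
  obtain ⟨D, hD, h'⟩ := (hG.fderiv_apply (0, 1)).isBigO.exists_pos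
  have hK : 0 < C + (|β| * C + D) / γ := by positivity
  filter_upwards [h.bound, h'.bound, Metric.ball_mem_nhds 0 (inv_pos.2 hK)]
    with p hp hp' hball hp0 h0
  have hpos : 0 < ‖p‖ := norm_pos_iff.2 hp0
  have hlt : ‖p‖ < (C + (|β| * C + D) / γ)⁻¹ := by simpa using hball
  rw [← one_div, lt_div_iff₀' hK] at hlt
  have h1 : -(β * p.1 + γ * p.2 + fderiv ℝ G p (0, 1)) = 0 := congrFun h0 1
  have h2 : p.1 + fderiv ℝ F p (0, 1) = 0 := congrFun h0 2
  simp only [norm_pow, norm_norm] at hp hp'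
  rw [Real.norm_eq_abs] at hp hp'
  have hu : |p.1| ≤ C * ‖p‖ ^ 2 := by
    rwa [show p.1 = -fderiv ℝ F p (0, 1) by linarith, abs_neg]
  have hv : γ * |p.2| ≤ (|β| * C + D) * ‖p‖ ^ 2 := by
    have hγv : γ * |p.2| = |γ * p.2| := by rw [abs_mul, abs_of_pos hγ]
    rw [hγv, show γ * p.2 = -(β * p.1) - fderiv ℝ G p (0, 1) by linarith]
    refine (abs_sub _ _).trans ?_
    rw [abs_neg, abs_mul]
    nlinarith [mul_le_mul_of_nonneg_left hu (abs_nonneg β)]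
  have hv' : |p.2| ≤ (|β| * C + D) / γ * ‖p‖ ^ 2 := by
    rw [div_mul_eq_mul_div, le_div_iff₀ hγ]
    linarith
  have hle : ‖p‖ ≤ (C + (|β| * C + D) / γ) * ‖p‖ ^ 2 := by
    refine max_le ?_ ?_ <;> rw [Real.norm_eq_abs]
    · have : 0 ≤ (|β| * C + D) / γ * ‖p‖ ^ 2 := by positivity
      linarith
    · have : 0 ≤ C * ‖p‖ ^ 2 := by positivity
      linarith
  nlinarith

end Umbrella

/-! ### Nonvanishing of points and coefficients -/

theorem polarPt_ne_zero {r : ℝ} (hr : r ≠ 0) (θ : ℝ) : polarPt r θ ≠ 0 := by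
  intro h
  have h1 : Real.cos θ = 0 := by simpa [polarPt, hr] using congrArg Prod.fst h
  have h2 : Real.sin θ = 0 := by simpa [polarPt, hr] using congrArg Prod.snd h
  simpa [h1, h2] using Real.sin_sq_add_cos_sq θ

theorem exists_quarticG_ne_zero (α β γ : ℝ) :
    ∃ θ ∈ {θ | Real.sin θ ≠ 0}, quarticG α β γ (Real.cos θ / Real.sin θ) ≠ 0 := by
  obtain ⟨s, hs⟩ : ∃ s, quarticG α β γ s ≠ 0 := by
    by_contra! h
    have h1 := h 2
    have h2 := h 1
    have h3 := h 0
    have h4 := h (-1)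
    have h5 := h (-2)
    simp only [quarticG] at h1 h2 h3 h4 h5
    -- The fourth difference of these five values is `24 (β² + 1)`, which is positive.
    nlinarith [sq_nonneg β]
  -- An angle with cotangent `s`.
  refine ⟨Real.pi / 2 - Real.arctan s, ?_, ?_⟩
  · simpa [Real.sin_pi_div_two_sub] using (Real.cos_arctan_pos s).ne'
  · rwa [Real.sin_pi_div_two_sub, Real.cos_pi_div_two_sub, ← Real.tan_eq_sin_div_cos,
      Real.tan_arctan]

theorem normSq_leadingCoeff_pos (β : ℝ) {γ θ : ℝ} (hγ : 0 < γ) (hθ : Real.sin θ ≠ 0) :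
    0 < Real.cos θ ^ 2 + (β * Real.cos θ + γ * Real.sin θ) ^ 2 := by
  rcases eq_or_ne (Real.cos θ) 0 with h0 | h0
  · rw [h0, mul_zero, zero_add]
    have : γ * Real.sin θ ≠ 0 := mul_ne_zero hγ.ne' hθ
    positivity
  · positivity

/-! ### Expansions along small circles -/

section LeadingTerms

variable {α β γ : ℝ} {F G : ℝ × ℝ → ℝ}

theorem hasLeadingTerm_polarPt_fst (θ : ℝ) :
    HasLeadingTerm 1 (fun r => (polarPt r θ).1) (Real.cos θ) :=
  (HasLeadingTerm.const_mul_pow 1 (Real.cos θ)).congr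
    (Eventually.of_forall fun r => by simp [polarPt, mul_comm]) rfl

theorem hasLeadingTerm_polarPt_snd (θ : ℝ) :
    HasLeadingTerm 1 (fun r => (polarPt r θ).2) (Real.sin θ) :=
  (HasLeadingTerm.const_mul_pow 1 (Real.sin θ)).congr
    (Eventually.of_forall fun r => by simp [polarPt, mul_comm]) rfl

theorem HasLeadingTerm.const_mul {m : ℕ} {A : ℝ → ℝ} {c : ℝ} (a : ℝ) (h : HasLeadingTerm m A c) :
    HasLeadingTerm m (fun r => a * A r) (a * c) :=
  (IsBigO.const_mul_left h a).congr_left fun r => by ring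

theorem hasLeadingTerm_umbrellaVelocity (hF : IsGermOfOrder 3 F) (hG : IsGermOfOrder 3 G)
    (θ : ℝ) :
    HasLeadingTerm 1 (fun r => umbrellaVelocity α β γ F G (polarPt r θ) 0) (-Real.sin θ) ∧
    HasLeadingTerm 2 (fun r => umbrellaVelocity α β γ F G (polarPt r θ) 1)
      (Real.cos θ ^ 2 - Real.sin θ ^ 2) ∧
    HasLeadingTerm 2 (fun r => umbrellaVelocity α β γ F G (polarPt r θ) 2)
      ((γ - α) * (Real.cos θ * Real.sin θ) + β * (Real.cos θ ^ 2 - Real.sin θ ^ 2)) := by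
  have hu := hasLeadingTerm_polarPt_fst θ
  have hv := hasLeadingTerm_polarPt_snd θ
  have hd := (hu.mul hu).sub (hv.mul hv)
  refine ⟨hv.neg, (hd.add (hF.angularDeriv.hasLeadingTerm θ)).congr .rfl (by ring),
    ((((hu.mul hv).const_mul (γ - α)).add (hd.const_mul β)).add
      (hG.angularDeriv.hasLeadingTerm θ)).congr .rfl (by ring)⟩

theorem hasLeadingTerm_umbrellaAcceleration (hF : IsGermOfOrder 3 F) (hG : IsGermOfOrder 3 G)
    (θ : ℝ) :
    HasLeadingTerm 1 (fun r => umbrellaAcceleration α β γ F G (polarPt r θ) 0) (-Real.cos θ) ∧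
    HasLeadingTerm 2 (fun r => umbrellaAcceleration α β γ F G (polarPt r θ) 1)
      (-4 * (Real.cos θ * Real.sin θ)) ∧
    HasLeadingTerm 2 (fun r => umbrellaAcceleration α β γ F G (polarPt r θ) 2)
      ((γ - α) * (Real.cos θ ^ 2 - Real.sin θ ^ 2) - 4 * β * (Real.cos θ * Real.sin θ)) := by
  have hu := hasLeadingTerm_polarPt_fst θ
  have hv := hasLeadingTerm_polarPt_snd θ
  have hd := (hu.mul hu).sub (hv.mul hv)
  have huv := hu.mul hv
  refine ⟨hu.neg, ((huv.const_mul (-4)).add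
      (hF.angularDeriv.angularDeriv.hasLeadingTerm θ)).congr .rfl (by ring),
    (((hd.const_mul (γ - α)).add (huv.const_mul (-4 * β))).add
      (hG.angularDeriv.angularDeriv.hasLeadingTerm θ)).congr .rfl (by ring)⟩

theorem hasLeadingTerm_umbrellaNormal (hF : IsGermOfOrder 3 F) (hG : IsGermOfOrder 3 G) (θ : ℝ) :
    HasLeadingTerm 1 (fun r => umbrellaNormal α β γ F G (polarPt r θ) 0) 0 ∧
    HasLeadingTerm 1 (fun r => umbrellaNormal α β γ F G (polarPt r θ) 1)
      (-(β * Real.cos θ + γ * Real.sin θ)) ∧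
    HasLeadingTerm 1 (fun r => umbrellaNormal α β γ F G (polarPt r θ) 2) (Real.cos θ) := by
  have hu := hasLeadingTerm_polarPt_fst θ
  have hv := hasLeadingTerm_polarPt_snd θ
  have hFu := (hF.fderiv_apply (1, 0)).hasLeadingTerm θ
  have hFv := (hF.fderiv_apply (0, 1)).hasLeadingTerm θ
  have hGu := (hG.fderiv_apply (1, 0)).hasLeadingTerm θ
  have hGv := (hG.fderiv_apply (0, 1)).hasLeadingTerm θ
  have hw := ((hu.const_mul β).add (hv.const_mul γ)).add hGv
  refine ⟨(((hv.add hFu).mul hw).sub ((((hu.const_mul α).add (hv.const_mul β)).add hGu).mul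
    (hu.add hFv))).of_lt (by norm_num), hw.neg.congr .rfl (by ring),
    (hu.add hFv).congr .rfl (by ring)⟩

theorem hasLeadingTerm_normSq_umbrellaVelocity (hF : IsGermOfOrder 3 F) (hG : IsGermOfOrder 3 G)
    (θ : ℝ) : HasLeadingTerm 2 (fun r => umbrellaVelocity α β γ F G (polarPt r θ) ⬝ᵥ
      umbrellaVelocity α β γ F G (polarPt r θ)) (Real.sin θ ^ 2) := by
  obtain ⟨h0, h1, h2⟩ := hasLeadingTerm_umbrellaVelocity (α := α) (β := β) (γ := γ) hF hG θ
  exact (((h0.mul h0).add ((h1.mul h1).of_lt (by norm_num))).add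
    ((h2.mul h2).of_lt (by norm_num))).congr
    (Eventually.of_forall fun r => by simp only [Matrix.vec3_dotProduct]) (by ring)

theorem hasLeadingTerm_normSq_umbrellaNormal (hF : IsGermOfOrder 3 F) (hG : IsGermOfOrder 3 G)
    (θ : ℝ) : HasLeadingTerm 2 (fun r => umbrellaNormal α β γ F G (polarPt r θ) ⬝ᵥ
      umbrellaNormal α β γ F G (polarPt r θ))
      (Real.cos θ ^ 2 + (β * Real.cos θ + γ * Real.sin θ) ^ 2) := by
  obtain ⟨h0, h1, h2⟩ := hasLeadingTerm_umbrellaNormal (α := α) (β := β) (γ := γ) hF hG θ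
  exact (((h0.mul h0).add (h1.mul h1)).add (h2.mul h2)).congr
    (Eventually.of_forall fun r => by simp only [Matrix.vec3_dotProduct]) (by ring)

theorem hasLeadingTerm_tripleProduct (hF : IsGermOfOrder 3 F) (hG : IsGermOfOrder 3 G)
    {θ : ℝ} (hθ : Real.sin θ ≠ 0) :
    HasLeadingTerm 4 (fun r => -(umbrellaAcceleration α β γ F G (polarPt r θ) ⬝ᵥ
      umbrellaVelocity α β γ F G (polarPt r θ) ⨯₃ umbrellaNormal α β γ F G (polarPt r θ)))
      (Real.sin θ ^ 4 * quarticG α β γ (Real.cos θ / Real.sin θ)) := by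
  obtain ⟨t0, t1, t2⟩ := hasLeadingTerm_umbrellaVelocity (α := α) (β := β) (γ := γ) hF hG θ
  obtain ⟨x0, x1, x2⟩ := hasLeadingTerm_umbrellaAcceleration (α := α) (β := β) (γ := γ) hF hG θ
  obtain ⟨n0, n1, n2⟩ := hasLeadingTerm_umbrellaNormal (α := α) (β := β) (γ := γ) hF hG θ
  -- All three summands of the triple product have order 4. The products with `n0` have order at
  -- least 3 and drop out against those of order 2.
  have h0 := x0.mul ((t1.mul n2).sub (t2.mul n1))
  have h1 := x1.mul (((t2.mul n0).of_lt (by norm_num : 2 < 2 + 1)).sub (t0.mul n2))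
  have h2 := x2.mul ((t0.mul n1).sub ((t1.mul n0).of_lt (by norm_num : 2 < 2 + 1)))
  refine ((h0.add h1).add h2).neg.congr (Eventually.of_forall fun r => ?_) ?_
  · simp only [cross_apply, Matrix.vec3_dotProduct]
    rfl
  · rw [quarticG]
    field_simp
    ring

theorem hasLeadingTerm_quotient {D T N : ℝ → ℝ} {d t n : ℝ} (hD : HasLeadingTerm 4 D d)
    (hT : HasLeadingTerm 2 T t) (hN : HasLeadingTerm 2 N n) (ht : t ≠ 0) (hn : 0 < n) :
    HasLeadingTerm 1 (fun r => (√(N r))⁻¹ * D r / T r) (d * (t⁻¹ * (√n)⁻¹)) := by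
  have hD' : HasLeadingTerm 0 (fun r => D r / r ^ 4) d := .div_pow (by simpa using hD)
  have hT' : HasLeadingTerm 0 (fun r => T r / r ^ 2) t := .div_pow (by simpa using hT)
  have hN' : HasLeadingTerm 0 (fun r => N r / r ^ 2) n := .div_pow (by simpa using hN)
  have h := (HasLeadingTerm.const_mul_pow 1 1).mul
    (hD'.mul ((hT'.inv ht).mul ((hN'.sqrt hn).inv (Real.sqrt_pos.2 hn).ne')))
  refine h.congr ?_ (by ring)
  filter_upwards [self_mem_nhdsWithin, hT.eventually_ne ht] with r hr hTr
  have hr : 0 < r := hr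
  rw [Real.sqrt_div' _ (by positivity), Real.sqrt_sq hr.le]
  -- If the root is zero, both sides are zero since the inverse of 0 is 0; no separate nonvanishing
  -- of `N` is required.
  rcases eq_or_ne √(N r) 0 with h0 | h0
  · simp [h0]
  · field_simp

end LeadingTerms

/-! ### Reduction of the normal form and conclusion -/

/-- The summand `j = 2` is the quadratic form. All other monomials have degree at least 3, and `R₁`,
`R₂` have order `k + 1 ≥ 3`. -/
theorem exists_umbrella_eq_whitneyNormalForm {k : ℕ} (hk : 3 ≤ k) (a : ℕ → ℕ → ℝ) (b : ℕ → ℝ)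
    {R₁ R₂ : ℝ × ℝ → ℝ} (hR₁ : IsGermOfOrder (k + 1) R₁) (hR₂ : IsGermOfOrder (k + 1) R₂) :
    ∃ F G, IsGermOfOrder 3 F ∧ IsGermOfOrder 3 G ∧
      whitneyNormalForm k a b R₁ R₂ = umbrella (a 2 0) (a 1 1) (a 0 2) F G := by
  refine ⟨fun p => ∑ i ∈ Finset.Icc 3 k, b i / (i.factorial : ℝ) * p.2 ^ i + R₁ p,
    fun p => ∑ j ∈ Finset.Icc 3 k, ∑ q ∈ Finset.HasAntidiagonal.antidiagonal j,
      a q.1 q.2 / ((q.1.factorial : ℝ) * (q.2.factorial : ℝ)) * (p.1 ^ q.1 * p.2 ^ q.2) + R₂ p,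
    ?_, ?_, ?_⟩
  · refine (IsGermOfOrder.sum _ fun i hi => ?_).add (hR₁.mono (by omega))
    exact ((IsGermOfOrder.snd.pow i).mono (by simp at hi; omega)).const_mul _
  · refine (IsGermOfOrder.sum _ fun j hj => .sum _ fun q hq => ?_).add (hR₂.mono (by omega))
    refine (((IsGermOfOrder.fst.pow q.1).mul (IsGermOfOrder.snd.pow q.2)).mono ?_).const_mul _
    rw [Finset.HasAntidiagonal.mem_antidiagonal] at hq
    simp at hj
    omega
  · funext p
    have hIcc : Finset.Icc 2 k = insert 2 (Finset.Icc 3 k) := by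
      ext i
      simp
      omega
    have h2 : Finset.HasAntidiagonal.antidiagonal 2 = {(0, 2), (1, 1), (2, 0)} := by decide
    simp only [whitneyNormalForm, umbrella]
    congr 1
    congr 1
    · ring
    · congr 1
      rw [hIcc, Finset.sum_insert (by simp), h2]
      simp [mul_assoc]
      ring

section Main

variable {α β γ : ℝ} {F G : ℝ × ℝ → ℝ}

theorem exists_isConormalFrame_umbrella (hγ : 0 < γ) (hF : IsGermOfOrder 3 F)
    (hG : IsGermOfOrder 3 G) : ∃ ρ : ℝ, 0 < ρ ∧ ∀ r : ℝ, 0 < r → r < ρ →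
      ∃ (l : ℝ → ℝ) (e bb n : ℝ → Fin 3 → ℝ) (κ₁ κ₂ κ₃ : ℝ → ℝ),
        IsConormalFrame (umbrella α β γ F G) r l e bb n κ₁ κ₂ κ₃ := by
  obtain ⟨ρ, hρ, h⟩ := exists_forall_polarPt (((hF.eventually_isRegularAt.and
    hG.eventually_isRegularAt).and (eventually_umbrellaVelocity_ne_zero (α := α) (β := β) (γ := γ)
      (G := G) hF)).and (eventually_umbrellaNormal_ne_zero (α := α) (β := β) hγ hF hG))
  refine ⟨ρ, hρ, fun r hr hrρ => ?_⟩
  have hF' := fun θ => (h r hr hrρ θ).1.1.1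
  have hG' := fun θ => (h r hr hrρ θ).1.1.2
  have hT := fun θ => (h r hr hrρ θ).1.2 (polarPt_ne_zero hr.ne' θ)
  have hN := fun θ => (h r hr hrρ θ).2 (polarPt_ne_zero hr.ne' θ)
  have hpos : ∀ θ, 0 < umbrellaNormal α β γ F G (polarPt r θ) ⬝ᵥ
      umbrellaNormal α β γ F G (polarPt r θ) := fun θ => by
    refine lt_of_le_of_ne (by simpa using dotProduct_star_self_nonneg (umbrellaNormal α β γ F G _)) ?_
    rw [ne_comm, ne_eq, dotProduct_self_eq_zero]
    exact hN θ
  have hν : ∀ θ, unitNormal (umbrella α β γ F G) (polarPt r θ) = _ := fun θ => by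
    rw [unitNormal, normalVec_umbrella (hF' θ).self (hG' θ).self]
  have hdN : Differentiable ℝ fun θ => umbrellaNormal α β γ F G (polarPt r θ) := fun θ =>
    differentiableAt_umbrellaNormal_polarPt (hF' θ) (hG' θ)
  refine exists_frenetFrame (fun θ => hasDerivAt_umbrella_polarPt (hF' θ).self (hG' θ).self)
    (fun θ => (hasDerivAt_umbrellaVelocity_polarPt (hF' θ).angular
      (hG' θ).angular).differentiableAt) ?_ (fun θ => ?_) (fun θ => ?_) fun θ => ?_
  · simp only [hν]
    intro θ
    have h1 := ((hdN θ).hasDerivAt.dotProduct_fin_three (hdN θ).hasDerivAt).differentiableAt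
    exact ((h1.sqrt (hpos θ).ne').inv (Real.sqrt_pos.2 (hpos θ)).ne').smul (hdN θ)
  · rw [ne_eq, dotProduct_self_eq_zero]
    exact hT θ
  · have h1 := Real.mul_self_sqrt (hpos θ).le
    have h2 := (Real.sqrt_pos.2 (hpos θ)).ne'
    rw [hν, smul_dotProduct, dotProduct_smul, smul_eq_mul, smul_eq_mul]
    field_simp
    rw [sq, h1]
  · rw [hν, dotProduct_smul, umbrellaVelocity_dotProduct_umbrellaNormal, smul_zero]

/-- The exponent is `4 - 2 - 1`, from the triple product, `|T|²` and `|N|`; dividing `sin⁴θ` by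
`sin²θ` leaves the factor `sin²θ`. -/
theorem hasLeadingTerm_kappa_two (hγ : 0 < γ) (hF : IsGermOfOrder 3 F) (hG : IsGermOfOrder 3 G)
    {ρ : ℝ} {l : ℝ → ℝ → ℝ} {e bb n : ℝ → ℝ → Fin 3 → ℝ} {κ₁ κ₂ κ₃ : ℝ → ℝ → ℝ} (hρ : 0 < ρ)
    (h : ∀ r : ℝ, 0 < r → r < ρ → IsConormalFrame (umbrella α β γ F G) r (l r) (e r) (bb r) (n r)
      (κ₁ r) (κ₂ r) (κ₃ r)) {θ : ℝ} (hθ : Real.sin θ ≠ 0) :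
    HasLeadingTerm 1 (fun r => κ₂ r θ) (quarticG α β γ (Real.cos θ / Real.sin θ) *
      (Real.sin θ ^ 2 * (√(Real.cos θ ^ 2 + (β * Real.cos θ + γ * Real.sin θ) ^ 2))⁻¹)) := by
  have hn : 0 < Real.cos θ ^ 2 + (β * Real.cos θ + γ * Real.sin θ) ^ 2 :=
    normSq_leadingCoeff_pos β hγ hθ
  have hT := hasLeadingTerm_normSq_umbrellaVelocity (α := α) (β := β) (γ := γ) hF hG θ
  refine (hasLeadingTerm_quotient 
    (hasLeadingTerm_tripleProduct (α := α) (β := β) (γ := γ) hF hG hθ) hT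
    (hasLeadingTerm_normSq_umbrellaNormal (α := α) hF hG θ) (pow_ne_zero 2 hθ) hn).congr ?_ ?_
  · obtain ⟨ρ', hρ', hreg⟩ := exists_forall_polarPt
      (hF.eventually_isRegularAt.and hG.eventually_isRegularAt)
    filter_upwards [hT.eventually_ne (pow_ne_zero 2 hθ), Ioo_mem_nhdsGT (lt_min hρ hρ')]
      with r hTr hr
    have hF' := fun t => (hreg r hr.1 (hr.2.trans_le (min_le_right _ _)) t).1
    have hG' := fun t => (hreg r hr.1 (hr.2.trans_le (min_le_right _ _)) t).2
    obtain ⟨hfr, hn⟩ := h r hr.1 (hr.2.trans_le (min_le_left _ _))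
    have key := hfr.kappa_two_mul
      (fun t => hasDerivAt_umbrella_polarPt (hF' t).self (hG' t).self)
      (hasDerivAt_umbrellaVelocity_polarPt (hF' θ).angular (hG' θ).angular) (hn θ)
    rw [unitNormal, normalVec_umbrella (hF' θ).self (hG' θ).self, map_smul, dotProduct_smul,
      smul_eq_mul] at key
    rw [div_eq_iff hTr, key]
    ring
  · field_simp

end Main

theorem mainTheorem7 (k : ℕ) (hk : 3 ≤ k) (a : ℕ → ℕ → ℝ) (b : ℕ → ℝ) (R₁ R₂ : ℝ × ℝ → ℝ)
    (ha : 0 < a 0 2) (hR₁ : IsGermOfOrder (k + 1) R₁) (hR₂ : IsGermOfOrder (k + 1) R₂) :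
    -- for small `r > 0` the frame exists
    (∃ ρ : ℝ, 0 < ρ ∧ ∀ r : ℝ, 0 < r → r < ρ →
      ∃ (l : ℝ → ℝ) (e bb n : ℝ → Fin 3 → ℝ) (κ₁ κ₂ κ₃ : ℝ → ℝ),
        IsConormalFrame (whitneyNormalForm k a b R₁ R₂) r l e bb n κ₁ κ₂ κ₃) ∧
    -- and for every choice of it `κ₂` has a first term, which vanishes exactly when `g(cot θ) = 0`
    ∀ (ρ : ℝ) (l : ℝ → ℝ → ℝ) (e bb n : ℝ → ℝ → Fin 3 → ℝ) (κ₁ κ₂ κ₃ : ℝ → ℝ → ℝ), 0 < ρ →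
      (∀ r : ℝ, 0 < r → r < ρ →
        IsConormalFrame (whitneyNormalForm k a b R₁ R₂) r (l r) (e r) (bb r) (n r)
          (κ₁ r) (κ₂ r) (κ₃ r)) →
      (∃ c : ℝ → ℝ, IsFirstTerm κ₂ {θ | Real.sin θ ≠ 0} c) ∧
      ∀ c : ℝ → ℝ, IsFirstTerm κ₂ {θ | Real.sin θ ≠ 0} c →
        ∀ θ : ℝ, Real.sin θ ≠ 0 →
          (c θ = 0 ↔
            quarticG (a 2 0) (a 1 1) (a 0 2) (Real.cos θ / Real.sin θ) = 0) := by
  obtain ⟨F, G, hF, hG, hf⟩ := exists_umbrella_eq_whitneyNormalForm hk a b hR₁ hR₂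
  rw [hf]
  refine ⟨exists_isConormalFrame_umbrella ha hF hG, fun ρ l e bb n κ₁ κ₂ κ₃ hρ h => ?_⟩
  have key := isFirstTerm_iff_of_hasLeadingTerm (exists_quarticG_ne_zero (a 2 0) (a 1 1) (a 0 2))
    (fun θ hθ => ?_) fun θ hθ => hasLeadingTerm_kappa_two ha hF hG hρ h hθ
  · exact ⟨⟨_, key.1⟩, key.2⟩
  · have hθ : Real.sin θ ≠ 0 := hθ
    have hn := normSq_leadingCoeff_pos (a 1 1) ha hθ
    exact mul_ne_zero (pow_ne_zero 2 hθ) (inv_ne_zero (Real.sqrt_pos.2 hn).ne')
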